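/- Let $n\ge 1$ and let $(M,g)$ be a smooth Riemannian manifold of dimension $2n+1$ with Levi-Civita connection $\nabla$. Let $\varphi,Q$ be smooth $(1,1)$-tensor fields, $\xi$ a smooth vector field and $\eta$ a smooth 1-form on $M$ such that $Q$ is nonsingular and $$\varphi^2=-Q+\eta\otimes\xi,\quad \eta(\xi)=1,\quad Q\xi=\xi,\quad \varphi(\ker\eta)\subset\ker\eta,\quad g(\varphi X,\varphi Y)=g(X,QY)-\eta(X)\eta(Y)$$ for all vector fields $X,Y$ (that is, $(\varphi,Q,\xi,\eta,g)$ is a weak almost contact metric structure). Assume that it is weak nearly Sasakian, i.e. $(\nabla_Y\varphi)Y=g(Y,Y)\,\xi-\eta(Y)\,Y$ for all smooth vector fields $Y$. Put $h=\nabla\xi+\varphi$ and $\widetilde Q=Q-\mathrm{id}_{TM}$. Then: (1) $h=0$ if and only if $(\varphi,\xi,\eta,g)$ is a Sasakian structure, i.e. an almost contact metric structure (a weak almost contact metric structure with $\mathrm{id}_{TM}$ in place of $Q$) with $(\nabla_X\varphi)Y=g(X,Y)\,\xi-\eta(Y)\,X$ for all smooth vector fields $X,Y$. (2) If $h=0$,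 then $\widetilde Q=0$; $d\eta(X,Y)=g(X,\varphi Y)$ for all smooth vector fields $X,Y$, where $d\eta(X,Y)=\frac12\{X(\eta(Y))-Y(\eta(X))-\eta([X,Y])\}$ (the structure is a weak contact metric structure); $\eta$ is a contact form, i.e. $\eta\wedge(d\eta)^n$ vanishes nowhere; and every sectional curvature of a plane containing $\xi$ equals $1$. -/

import Mathlib

open Bundle VectorField FiberBundle
open scoped Manifold ContDiff

noncomputable section

namespace WeakContact

set_option linter.unusedSectionVars false

set_option linter.unusedSectionVars false

section LeviCivita

variable {E : Type*} [NormedAddCommGroup E] [NormedSpace ℝ E] [FiniteDimensional ℝ E]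
  {H : Type*} [TopologicalSpace H] {I : ModelWithCorners ℝ E H}
  {M : Type*} [TopologicalSpace M] [ChartedSpace H M] [IsManifold I ∞ M]
  [RiemannianBundle (fun x : M ↦ TangentSpace I x)]
  [IsContMDiffRiemannianBundle I ∞ E (fun x : M ↦ TangentSpace I x)]

/-- The function `g(X, Y)` on the manifold. -/
def ip (X Y : Π x : M, TangentSpace I x) : M → ℝ := fun x ↦ inner ℝ (X x) (Y x)

lemma ip_comm (X Y : Π x : M, TangentSpace I x) : ip X Y = ip Y X := by
  funext x; exact real_inner_comm _ _

/-- The Koszul expression, i.e. the value of `g(∇_X Y, Z)` at `x` (the differentiated field `Y` is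
the first argument). -/
def koszul (Y X Z : Π x : M, TangentSpace I x) (x : M) : ℝ :=
  (1 / 2) * (mvfderiv I (ip Y Z) x (X x) + mvfderiv I (ip Z X) x (Y x)
    - mvfderiv I (ip X Y) x (Z x)
    + inner ℝ (mlieBracket I X Y x) (Z x) - inner ℝ (mlieBracket I Y Z x) (X x)
    - inner ℝ (mlieBracket I X Z x) (Y x))

variable {X X' Y Z Z' : Π x : M, TangentSpace I x} {x : M} {f : M → ℝ}

lemma mdiff_ip (hX : MDiffAt (T% X) x) (hY : MDiffAt (T% Y) x) : MDiffAt (ip X Y) x :=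
  by
  have := @MDifferentiableAt.inner_bundle E _ _ H _ I M _ _ E _ _ (fun x : M ↦ TangentSpace I x) _ _ _ _ _ E _ _ H _ I M _ _ _ id X Y x hX hY
  exact this

lemma mvfderiv_ip_add_left (hX : MDiffAt (T% X) x) (hX' : MDiffAt (T% X') x)
    (hY : MDiffAt (T% Y) x) :
    mvfderiv I (ip (X + X') Y) x = mvfderiv I (ip X Y) x + mvfderiv I (ip X' Y) x := by
  rw [← mvfderiv_add (mdiff_ip hX hY) (mdiff_ip hX' hY)]
  congr 1
  funext y
  simp [ip, inner_add_left]

lemma mvfderiv_ip_smul_left (hf : MDiffAt f x) (hX : MDiffAt (T% X) x) (hY : MDiffAt (T% Y) x) :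
    mvfderiv I (ip (f • X) Y) x
      = f x • mvfderiv I (ip X Y) x + ip X Y x • mvfderiv I f x := by
  rw [← mvfderiv_mul hf (mdiff_ip hX hY)]
  congr 1
  funext y
  simp [ip, inner_smul_left]

lemma mvfderiv_ip_add_right (hX : MDiffAt (T% X) x) (hX' : MDiffAt (T% X') x)
    (hY : MDiffAt (T% Y) x) :
    mvfderiv I (ip Y (X + X')) x = mvfderiv I (ip Y X) x + mvfderiv I (ip Y X') x := by
  rw [ip_comm, mvfderiv_ip_add_left hX hX' hY, ip_comm X, ip_comm X']

lemma mvfderiv_ip_smul_right (hf : MDiffAt f x) (hX : MDiffAt (T% X) x) (hY : MDiffAt (T% Y) x) :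
    mvfderiv I (ip Y (f • X)) x
      = f x • mvfderiv I (ip Y X) x + ip Y X x • mvfderiv I f x := by
  rw [ip_comm, mvfderiv_ip_smul_left hf hX hY, ip_comm X]

lemma koszul_tensorial_left (hY : MDiffAt (T% Y) x) (hZ : MDiffAt (T% Z) x) :
    TensorialAt I E (fun X ↦ koszul Y X Z x) x where
  smul {f X} hf hX := by
    simp only [koszul, mvfderiv_ip_smul_right hf hX hZ, mvfderiv_ip_smul_left hf hX hY,
      mlieBracket_smul_left hf hX]
    simp [ip, inner_add_left, inner_smul_left, inner_smul_right, real_inner_comm (X x)]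
    ring
  add {X X'} hX hX' := by
    simp only [koszul, mvfderiv_ip_add_right hX hX' hZ, mvfderiv_ip_add_left hX hX' hY,
      mlieBracket_add_left hX hX']
    simp [inner_add_left, inner_add_right]
    ring

lemma koszul_tensorial_right (hY : MDiffAt (T% Y) x) (hX : MDiffAt (T% X) x) :
    TensorialAt I E (fun Z ↦ koszul Y X Z x) x where
  smul {f Z} hf hZ := by
    simp only [koszul, mvfderiv_ip_smul_right hf hZ hY, mvfderiv_ip_smul_left hf hZ hX,
      mlieBracket_smul_right hf hZ]
    simp [ip, inner_add_left, inner_smul_left, inner_smul_right, real_inner_comm (Z x)]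
    ring
  add {Z Z'} hZ hZ' := by
    simp only [koszul, mvfderiv_ip_add_right hZ hZ' hY, mvfderiv_ip_add_left hZ hZ' hX,
      mlieBracket_add_right hZ hZ']
    simp [inner_add_left, inner_add_right]
    ring

open Classical in
/-- At a point where `Y` is differentiable, `leviCivitaFun Y x u` is the vector `∇_u Y` determined
by the Koszul formula `g(∇_X Y, Z) = koszul Y X Z` (see `inner_leviCivitaFun`); elsewhere it is the
junk value `0`. -/
def leviCivitaFun (Y : Π x : M, TangentSpace I x) (x : M) :
    TangentSpace I x →L[ℝ] TangentSpace I x :=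
  if hY : MDiffAt (T% Y) x then
    haveI : FiniteDimensional ℝ (TangentSpace I x) := inferInstanceAs (FiniteDimensional ℝ E)
    haveI : CompleteSpace (TangentSpace I x) := FiniteDimensional.complete ℝ _
    let B := TensorialAt.mkHom₂ (I := I) (F := E) (F' := E) (fun X Z ↦ koszul Y X Z x) x
      (fun _ hZ ↦ koszul_tensorial_left hY hZ) (fun _ hX ↦ koszul_tensorial_right hY hX)
    LinearMap.toContinuousLinearMap
      { toFun := fun u ↦ (InnerProductSpace.toDual ℝ (TangentSpace I x)).symm (B u)
        map_add' := fun u v ↦ by simp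
        map_smul' := fun c u ↦ by simp }
  else 0

lemma inner_leviCivitaFun (hY : MDiffAt (T% Y) x) (hX : MDiffAt (T% X) x)
    (hZ : MDiffAt (T% Z) x) :
    inner ℝ (leviCivitaFun Y x (X x)) (Z x) = koszul Y X Z x := by
  rw [← TensorialAt.mkHom₂_apply (I := I) (F := E) (F' := E) (Φ := fun X Z ↦ koszul Y X Z x)
      (fun _ hZ ↦ koszul_tensorial_left hY hZ) (fun _ hX ↦ koszul_tensorial_right hY hX) hX hZ]
  simp [leviCivitaFun, hY]


lemma eq_of_inner_fields {u v : TangentSpace I x}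
    (h : ∀ Z : Π x : M, TangentSpace I x, MDiffAt (T% Z) x → inner ℝ u (Z x) = inner ℝ v (Z x)) :
    u = v := by
  refine ext_inner_right ℝ fun w ↦ ?_
  have := h (extend E w) (mdifferentiableAt_extend ..)
  simpa using this

lemma clm_eq_of_fields {A B : TangentSpace I x →L[ℝ] TangentSpace I x}
    (h : ∀ X Z : Π x : M, TangentSpace I x, MDiffAt (T% X) x → MDiffAt (T% Z) x →
      inner ℝ (A (X x)) (Z x) = inner ℝ (B (X x)) (Z x)) : A = B := by
  ext u
  refine eq_of_inner_fields fun Z hZ ↦ ?_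
  simpa using h (extend E u) Z (mdifferentiableAt_extend ..) hZ

variable (I M) in
/-- The Levi-Civita connection of the Riemannian metric: `leviCivita I M Y x u` is `∇_u Y` at `x`.
It is torsion-free and metric, see `leviCivita_torsion` and `leviCivita_metric`. -/
def leviCivita : CovariantDerivative I E (fun x : M ↦ TangentSpace I x) where
  toFun := leviCivitaFun
  isCovariantDerivativeOnUniv :=
    { add := by
        intro Y Y' x hY hY' _
        refine clm_eq_of_fields fun X Z hX hZ ↦ ?_
        have hs : MDiffAt (T% (Y + Y')) x := mdifferentiableAt_add_section hY hY'
        rw [inner_leviCivitaFun hs hX hZ]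
        simp only [add_apply, inner_add_left]
        rw [inner_leviCivitaFun hY hX hZ, inner_leviCivitaFun hY' hX hZ]
        simp only [koszul, mvfderiv_ip_add_right hY hY' hX, mvfderiv_ip_add_left hY hY' hZ,
          mlieBracket_add_left hY hY', mlieBracket_add_right hY hY']
        simp [inner_add_left, inner_add_right]
        ring
      leibniz := by
        intro Y f x hY hf _
        refine clm_eq_of_fields fun X Z hX hZ ↦ ?_
        have hs : MDiffAt (T% (f • Y)) x := hf.smul_section hY
        rw [inner_leviCivitaFun hs hX hZ]
        simp only [add_apply, inner_add_left]
        simp only [smul_apply, inner_smul_left]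
        rw [inner_leviCivitaFun hY hX hZ]
        simp only [koszul, mvfderiv_ip_smul_right hf hY hX, mvfderiv_ip_smul_left hf hY hZ,
          mlieBracket_smul_left hf hY, mlieBracket_smul_right hf hY]
        simp [ip, inner_add_left, inner_smul_left, inner_smul_right, real_inner_comm (X x) (Y x)]
        ring }

lemma leviCivita_torsion : (leviCivita I M).torsion = 0 := by
  rw [CovariantDerivative.torsion_eq_zero_iff]
  intro X Y x hX hY
  refine eq_of_inner_fields fun Z hZ ↦ ?_
  rw [inner_sub_left]
  erw [inner_leviCivitaFun hY hX hZ, inner_leviCivitaFun hX hY hZ]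
  simp only [koszul, ip_comm Y Z, ip_comm Z X, ip_comm Y X, mlieBracket_swap_apply (V := Y) (W := X)]
  simp
  ring

lemma leviCivita_metric (hY : MDiffAt (T% Y) x) (hZ : MDiffAt (T% Z) x) (u : TangentSpace I x) :
    mvfderiv I (ip Y Z) x u
      = inner ℝ (leviCivita I M Y x u) (Z x) + inner ℝ (Y x) (leviCivita I M Z x u) := by
  have hu : MDiffAt (T% (extend E u)) x := mdifferentiableAt_extend ..
  have h₁ := inner_leviCivitaFun hY hu hZ
  have h₂ := inner_leviCivitaFun hZ hu hY
  rw [extend_apply_self] at h₁ h₂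
  change _ = inner ℝ (leviCivitaFun Y x u) (Z x) + inner ℝ (Y x) (leviCivitaFun Z x u)
  rw [h₁, real_inner_comm, h₂]
  simp only [koszul, ip_comm Z Y, ip_comm Z (extend E u), ip_comm (extend E u) Y,
    mlieBracket_swap_apply (V := Z) (W := Y), extend_apply_self, inner_neg_left]
  ring

end LeviCivita

/-! ### Vector fields, endomorphism fields, one-forms -/

section Tensors

variable {E : Type*} [NormedAddCommGroup E] [NormedSpace ℝ E]
  {H : Type*} [TopologicalSpace H] {I : ModelWithCorners ℝ E H}
  {M : Type*} [TopologicalSpace M] [ChartedSpace H M] [IsManifold I ∞ M]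

/-- `X` is a smooth vector field. -/
def IsSmoothField (X : Π x : M, TangentSpace I x) : Prop :=
  ContMDiff I I.tangent ∞ (fun x ↦ (⟨x, X x⟩ : TangentBundle I M))

/-- `A` is a smooth `(1,1)`-tensor field. -/
def IsSmoothEnd (A : Π x : M, TangentSpace I x →L[ℝ] TangentSpace I x) : Prop :=
  ContMDiff I (I.prod 𝓘(ℝ, E →L[ℝ] E)) ∞
    (fun x ↦ TotalSpace.mk' (E →L[ℝ] E)
      (E := fun x : M ↦ TangentSpace I x →L[ℝ] TangentSpace I x) x (A x))

/-- `η` is a smooth 1-form. -/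
def IsSmoothForm (η : Π x : M, TangentSpace I x →L[ℝ] ℝ) : Prop :=
  ContMDiff I (I.prod 𝓘(ℝ, E →L[ℝ] ℝ)) ∞
    (fun x ↦ TotalSpace.mk' (E →L[ℝ] ℝ) (E := fun x : M ↦ TangentSpace I x →L[ℝ] ℝ) x (η x))

/-- The exterior derivative `dη(X, Y) = ½ (X(η(Y)) - Y(η(X)) - η([X, Y]))`. -/
def extD (η : Π x : M, TangentSpace I x →L[ℝ] ℝ) (X Y : Π x : M, TangentSpace I x) (x : M) : ℝ :=
  (1 / 2) * (mvfderiv I (fun y ↦ η y (Y y)) x (X x) - mvfderiv I (fun y ↦ η y (X y)) x (Y x)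
    - η x (mlieBracket I X Y x))

/-- The value of `η ∧ (dη)ⁿ` on the vector fields `X₀, …, X₂ₙ`, at the point `x`. Like `extD`, it
uses the normalization in which a wedge product is the full antisymmetrization (with the factor
`1 / (2n+1)!`) of the tensor product. -/
def wedgeContact (n : ℕ) (η : Π x : M, TangentSpace I x →L[ℝ] ℝ)
    (X : Fin (2 * n + 1) → Π x : M, TangentSpace I x) (x : M) : ℝ :=
  (1 / ((2 * n + 1).factorial : ℝ)) * ∑ σ : Equiv.Perm (Fin (2 * n + 1)),
    ((Equiv.Perm.sign σ : ℤ) : ℝ) * (η x (X (σ 0) x) *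
      ∏ i : Fin n, extD η (X (σ ⟨2 * i.1 + 1, by omega⟩)) (X (σ ⟨2 * i.1 + 2, by omega⟩)) x)

/-- `η` is a contact form on a `(2n+1)`-manifold: `η ∧ (dη)ⁿ` vanishes at no point. -/
def IsContactForm (n : ℕ) (η : Π x : M, TangentSpace I x →L[ℝ] ℝ) : Prop :=
  ∀ x : M, ∃ X : Fin (2 * n + 1) → Π x : M, TangentSpace I x,
    (∀ i, IsSmoothField (X i)) ∧ wedgeContact n η X x ≠ 0

/-- A weak almost contact structure `(φ, Q, ξ, η)`. -/
structure IsWeakAlmostContact (φ Q : Π x : M, TangentSpace I x →L[ℝ] TangentSpace I x)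
    (ξ : Π x : M, TangentSpace I x) (η : Π x : M, TangentSpace I x →L[ℝ] ℝ) : Prop where
  smooth_phi : IsSmoothEnd φ
  smooth_Q : IsSmoothEnd Q
  smooth_xi : IsSmoothField ξ
  smooth_eta : IsSmoothForm η
  nonsingular : ∀ x, Function.Bijective (Q x)
  phi_sq : ∀ x (u : TangentSpace I x), φ x (φ x u) = -Q x u + η x u • ξ x
  eta_xi : ∀ x, η x (ξ x) = 1
  Q_xi : ∀ x, Q x (ξ x) = ξ x
  ker_invariant : ∀ x (u : TangentSpace I x), η x u = 0 → η x (φ x u) = 0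

end Tensors

/-! ### Metric structures -/

section Metric

variable {E : Type*} [NormedAddCommGroup E] [NormedSpace ℝ E] [FiniteDimensional ℝ E]
  {H : Type*} [TopologicalSpace H] {I : ModelWithCorners ℝ E H}
  {M : Type*} [TopologicalSpace M] [ChartedSpace H M] [IsManifold I ∞ M]
  [RiemannianBundle (fun x : M ↦ TangentSpace I x)]
  [IsContMDiffRiemannianBundle I ∞ E (fun x : M ↦ TangentSpace I x)]

/-- The vector field `∇_X Y`. -/
def nabla (X Y : Π x : M, TangentSpace I x) : Π x : M, TangentSpace I x :=
  fun x ↦ leviCivita I M Y x (X x)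

/-- `(∇_X φ) Y = ∇_X (φ Y) - φ (∇_X Y)`. -/
def nablaEnd (φ : Π x : M, TangentSpace I x →L[ℝ] TangentSpace I x)
    (X Y : Π x : M, TangentSpace I x) : Π x : M, TangentSpace I x :=
  fun x ↦ nabla X (fun y ↦ φ y (Y y)) x - φ x (nabla X Y x)

/-- `R_{X,Y} Z = ∇_X ∇_Y Z - ∇_Y ∇_X Z - ∇_{[X,Y]} Z`. -/
def curvature (X Y Z : Π x : M, TangentSpace I x) : Π x : M, TangentSpace I x :=
  fun x ↦ nabla X (nabla Y Z) x - nabla Y (nabla X Z) x - nabla (mlieBracket I X Y) Z x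

/-- The sectional curvature at `x` of the plane spanned by `X x` and `Y x`. -/
def sectionalCurvature (X Y : Π x : M, TangentSpace I x) (x : M) : ℝ :=
  (inner ℝ (curvature X Y Y x) (X x) : ℝ) /
    ((inner ℝ (X x) (X x) : ℝ) * inner ℝ (Y x) (Y x) - (inner ℝ (X x) (Y x) : ℝ) ^ 2)

/-- A weak almost contact metric structure `(φ, Q, ξ, η, g)`. -/
structure IsWeakAlmostContactMetric (φ Q : Π x : M, TangentSpace I x →L[ℝ] TangentSpace I x)
    (ξ : Π x : M, TangentSpace I x) (η : Π x : M, TangentSpace I x →L[ℝ] ℝ) : Prop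
    extends IsWeakAlmostContact φ Q ξ η where
  compatible : ∀ x (u v : TangentSpace I x),
    (inner ℝ (φ x u) (φ x v) : ℝ) = inner ℝ u (Q x v) - η x u * η x v

/-- A weak contact metric structure: `dη(X, Y) = g(X, φ Y)`. -/
structure IsWeakContactMetric (φ Q : Π x : M, TangentSpace I x →L[ℝ] TangentSpace I x)
    (ξ : Π x : M, TangentSpace I x) (η : Π x : M, TangentSpace I x →L[ℝ] ℝ) : Prop
    extends IsWeakAlmostContactMetric φ Q ξ η where
  extD_eq : ∀ X Y : Π x : M, TangentSpace I x, IsSmoothField X → IsSmoothField Y →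
    ∀ x, extD η X Y x = inner ℝ (X x) (φ x (Y x))

/-- A weak nearly Sasakian structure: `(∇_Y φ) Y = g(Y, Y) ξ - η(Y) Y`. -/
structure IsWeakNearlySasakian (φ Q : Π x : M, TangentSpace I x →L[ℝ] TangentSpace I x)
    (ξ : Π x : M, TangentSpace I x) (η : Π x : M, TangentSpace I x →L[ℝ] ℝ) : Prop
    extends IsWeakAlmostContactMetric φ Q ξ η where
  nearly : ∀ Y : Π x : M, TangentSpace I x, IsSmoothField Y →
    ∀ x, nablaEnd φ Y Y x = (inner ℝ (Y x) (Y x) : ℝ) • ξ x - η x (Y x) • Y x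

/-- An almost contact metric structure is a weak one with `Q = id`. -/
def IsAlmostContactMetric (φ : Π x : M, TangentSpace I x →L[ℝ] TangentSpace I x)
    (ξ : Π x : M, TangentSpace I x) (η : Π x : M, TangentSpace I x →L[ℝ] ℝ) : Prop :=
  IsWeakAlmostContactMetric φ (fun x ↦ ContinuousLinearMap.id ℝ (TangentSpace I x)) ξ η

/-- A Sasakian structure `(φ, ξ, η, g)`: an almost contact metric structure with
`(∇_X φ) Y = g(X, Y) ξ - η(Y) X`. -/
structure IsSasakian (φ : Π x : M, TangentSpace I x →L[ℝ] TangentSpace I x)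
    (ξ : Π x : M, TangentSpace I x) (η : Π x : M, TangentSpace I x →L[ℝ] ℝ) : Prop where
  almostContactMetric : IsAlmostContactMetric φ ξ η
  sasaki : ∀ X Y : Π x : M, TangentSpace I x, IsSmoothField X → IsSmoothField Y →
    ∀ x, nablaEnd φ X Y x = (inner ℝ (X x) (Y x) : ℝ) • ξ x - η x (Y x) • X x

/-- The tensor `h = ∇ξ + φ`. -/
def hTensor (φ : Π x : M, TangentSpace I x →L[ℝ] TangentSpace I x)
    (ξ : Π x : M, TangentSpace I x) : Π x : M, TangentSpace I x →L[ℝ] TangentSpace I x :=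
  fun x ↦ leviCivita I M ξ x + φ x

/-- The tensor `Q̃ = Q - id`. -/
def QTilde (Q : Π x : M, TangentSpace I x →L[ℝ] TangentSpace I x) :
    Π x : M, TangentSpace I x →L[ℝ] TangentSpace I x :=
  fun x ↦ Q x - ContinuousLinearMap.id ℝ (TangentSpace I x)

end Metric

end WeakContact

end

noncomputable section

namespace WeakContact

/-! ### Smooth fields and the pointwise algebra of a weak almost contact structure. -/

section SmoothFields

variable {E : Type*} [NormedAddCommGroup E] [NormedSpace ℝ E]
  {H : Type*} [TopologicalSpace H] {I : ModelWithCorners ℝ E H}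
  {M : Type*} [TopologicalSpace M] [ChartedSpace H M] [IsManifold I ∞ M]
  {X Y Z : Π x : M, TangentSpace I x} {f : M → ℝ}

/-! Suppose `∇ξ = -φ`. Since the connection is torsion-free and `φ` is skew, `dη = g(·, φ·)`; then
`d(dη) = 0` makes the cyclic sum of `T(X,Y,Z) = g((∇_X φ)Y, Z)` vanish (`extD_cyclic_sum`,
`cyclic_sum_nablaEnd`). The nearly Sasakian condition prescribes the part of `T` symmetric in `X,
Y`, and `T` is skew in `Y, Z`. These linear relations determine `T`, and the solution is the
Sasakian formula (`nablaEnd_eq_of_hTensor_eq_zero`).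

Putting `Y = ξ` in that formula compares `φ²X` with `η(X)ξ - X`, which forces `Q = id`. The formula
also gives `∇_ξ φ = 0`, whence `R(X,ξ)ξ = -φ²X = X - η(X)ξ` and curvature one.

For the contact condition, a frame `ξ, e_i, φ e_i` puts `dη` in standard symplectic form
(`exists_adapted_frame`). In the antisymmetrized sum all nonzero terms then have the same sign
(`sum_sign_mul_prod_ne_zero`), so nothing cancels.

Conversely, in a Sasakian structure `Y = ξ` gives `φ(hX) = 0`, while `|ξ| = 1` gives `η(hX) = 0`;
the formula for `φ²` then yields `hX = 0`. -/

lemma IsSmoothField.mdiffAt (hX : IsSmoothField X) (x : M) : MDiffAt (T% X) x :=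
  (hX x).mdifferentiableAt (by simp)

lemma IsSmoothField.add (hX : IsSmoothField X) (hY : IsSmoothField Y) : IsSmoothField (X + Y) :=
  ContMDiff.add_section hX hY

lemma IsSmoothField.smul (hf : ContMDiff I 𝓘(ℝ) ∞ f) (hX : IsSmoothField X) :
    IsSmoothField (f • X) :=
  ContMDiff.smul_section hf hX

lemma IsSmoothEnd.apply {φ : Π x : M, TangentSpace I x →L[ℝ] TangentSpace I x}
    (hφ : IsSmoothEnd φ) (hX : IsSmoothField X) : IsSmoothField (fun x ↦ φ x (X x)) :=
  ContMDiff.clm_bundle_apply (b := id) hφ hX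

lemma contMDiff_mvfderiv_apply (hf : ContMDiff I 𝓘(ℝ) ∞ f) (hX : IsSmoothField X) :
    ContMDiff I 𝓘(ℝ) ∞ (fun x ↦ mvfderiv I f x (X x)) := by
  have h₁ := (hf.contMDiff_tangentMap (m := ∞) (by simp)).comp hX
  exact (contMDiff_snd_tangentBundle_modelSpace ℝ 𝓘(ℝ)).comp h₁

variable {φ Q : Π x : M, TangentSpace I x →L[ℝ] TangentSpace I x}
  {ξ : Π x : M, TangentSpace I x} {η : Π x : M, TangentSpace I x →L[ℝ] ℝ}

namespace IsWeakAlmostContact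

variable (h : IsWeakAlmostContact φ Q ξ η)
include h

/-- Since `φ²ξ = 0`, the formula for `φ²` at `φξ` reads `Q(φξ) = cξ = Q(cξ)` with `c = η(φξ)`.
Injectivity of `Q` gives `φξ = cξ`, and then `φ²ξ = 0` forces `c² = 0`. -/
lemma phi_xi (x : M) : φ x (ξ x) = 0 := by
  have h₂ : φ x (φ x (ξ x)) = 0 := by rw [h.phi_sq, h.Q_xi, h.eta_xi]; simp
  have h₃ := h.phi_sq x (φ x (ξ x))
  rw [h₂, map_zero] at h₃
  have h₄ : Q x (φ x (ξ x)) = Q x (η x (φ x (ξ x)) • ξ x) := by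
    rw [map_smul, h.Q_xi]
    exact neg_add_eq_zero.1 h₃.symm
  have h₅ : φ x (ξ x) = η x (φ x (ξ x)) • ξ x := (h.nonsingular x).1 h₄
  have h₆ : η x (φ x (ξ x)) = 0 := by
    rw [h₅, map_smul] at h₂
    have := congrArg (η x) h₂
    simp only [map_smul, map_zero, smul_eq_mul] at this
    exact mul_self_eq_zero.1 this
  rw [h₅, h₆, zero_smul]

lemma eta_phi (x : M) (u : TangentSpace I x) : η x (φ x u) = 0 := by
  have := h.ker_invariant x (u - η x u • ξ x) (by simp [h.eta_xi])
  simpa [h.phi_xi] using this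

/-- Both sides come from `φ³`, computed as `φ²∘φ` and as `φ∘φ²`. -/
lemma Q_phi (x : M) (u : TangentSpace I x) : Q x (φ x u) = φ x (Q x u) := by
  have h₁ := h.phi_sq x (φ x u)
  rw [h.phi_sq x u, h.eta_phi] at h₁
  simp only [map_add, map_neg, map_smul, h.phi_xi, smul_zero, zero_smul, add_zero] at h₁
  exact (neg_injective h₁).symm

end IsWeakAlmostContact

/-! ### Lie brackets, global extension of tangent vectors, and `d² = 0`. -/

variable [FiniteDimensional ℝ E]

lemma IsSmoothField.mlieBracket (hX : IsSmoothField X) (hY : IsSmoothField Y) :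
    IsSmoothField (mlieBracket I X Y) := by
  have : IsManifold I (((⊤ : ℕ∞) : WithTop ℕ∞) + 1) M := by simpa using ‹IsManifold I ∞ M›
  have : IsManifold I (minSmoothness ℝ 2) M :=
    IsManifold.of_le (n := ∞) (by simpa using ENat.LEInfty.out)
  exact fun x ↦ ContMDiffAt.mlieBracket_vectorField (m := ⊤) (n := ⊤) (hX x) (hY x) (by simp)

/-- Every tangent vector is the value of a globally smooth vector field. -/
lemma exists_isSmoothField_eq [T2Space M] (x : M) (v : TangentSpace I x) :
    ∃ X : Π y : M, TangentSpace I y, IsSmoothField X ∧ X x = v := by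
  obtain ⟨s, hs, hsm⟩ := exists_contMDiffOn_extend (k := ∞) I E v
  obtain ⟨t, hts, ht, hxt⟩ := mem_nhds_iff.1 hs
  -- The bump function is supported where the local extension is smooth, so the product is smooth
  -- there and locally zero elsewhere.
  obtain ⟨f, -, hf⟩ := (SmoothBumpFunction.nhds_basis_tsupport (I := I) x).mem_iff.1
    (ht.mem_nhds hxt)
  refine ⟨(f : M → ℝ) • extend E v, fun y ↦ ?_, by simp⟩
  by_cases hy : y ∈ t
  · exact ContMDiffAt.smul_section f.contMDiffAt
      ((hsm y (hts hy)).contMDiffAt (Filter.mem_of_superset (ht.mem_nhds hy) hts))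
  · have hy' : y ∉ tsupport f := fun h ↦ hy (hf h)
    have h0 : ContMDiffAt I I.tangent ∞
        (T% (0 : Π y : M, TangentSpace I y)) y := contMDiff_zeroSection ..
    refine h0.congr_of_eventuallyEq ?_
    filter_upwards [(isClosed_tsupport f).isOpen_compl.mem_nhds hy'] with z hz
    simp [image_eq_zero_of_notMem_tsupport hz]

/-- A Lie bracket acts on functions as the commutator of derivations. -/
lemma mvfderiv_mlieBracket [T2Space M] (hf : ContMDiff I 𝓘(ℝ) ∞ f) (hX : IsSmoothField X)
    (hY : IsSmoothField Y) (x : M) :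
    mvfderiv I f x (mlieBracket I X Y x)
      = mvfderiv I (fun y ↦ mvfderiv I f y (Y y)) x (X x)
        - mvfderiv I (fun y ↦ mvfderiv I f y (X y)) x (Y x) := by
  have : IsManifold I (minSmoothness ℝ 3) M := 
    IsManifold.of_le (n := ∞) (by simpa using ENat.LEInfty.out)
  have d : ∀ {g : M → ℝ}, ContMDiff I 𝓘(ℝ) ∞ g → ∀ y, MDiffAt g y :=
    fun hg y ↦ (hg y).mdifferentiableAt (by simp)
  have two : ∀ {Z : Π x : M, TangentSpace I x}, IsSmoothField Z →
      CMDiffAt (minSmoothness ℝ 2) (T% Z) x := fun hZ ↦ by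
    simpa using (hZ x).of_le (m := 2) ENat.LEInfty.out
  have bracket : ∀ {Z W : Π x : M, TangentSpace I x} {g : M → ℝ}, ContMDiff I 𝓘(ℝ) ∞ g →
      IsSmoothField W → mlieBracket I Z (g • W)
        = (fun y ↦ mvfderiv I g y (Z y)) • W + g • mlieBracket I Z W := by
    intro Z W g hg hW
    funext y
    simpa using mlieBracket_smul_right (V := Z) (d hg y) (hW.mdiffAt y)
  -- Compare the Jacobi identity for `X, Y, fW` with `f` times the one for `X, Y, W`: by the Leibniz
  -- rule all that survives is the claimed difference times `W`, and `W x` is arbitrary.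
  have key : ∀ v : TangentSpace I x, (mvfderiv I f x (mlieBracket I X Y x)
      - (mvfderiv I (fun y ↦ mvfderiv I f y (Y y)) x (X x)
        - mvfderiv I (fun y ↦ mvfderiv I f y (X y)) x (Y x))) • v = 0 := by
    intro v
    obtain ⟨W, hW, rfl⟩ := exists_isSmoothField_eq x v
    have hXf := contMDiff_mvfderiv_apply hf hX
    have hYf := contMDiff_mvfderiv_apply hf hY
    have J := leibniz_identity_mlieBracket_apply (two hX) (two hY) (two (hW.smul hf))
    have J₀ := leibniz_identity_mlieBracket_apply (two hX) (two hY) (two hW)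
    rw [bracket hf hW, bracket hf hW, bracket hf hW,
      mlieBracket_add_right ((hW.smul hYf).mdiffAt x) (((hY.mlieBracket hW).smul hf).mdiffAt x),
      mlieBracket_add_right ((hW.smul hXf).mdiffAt x) (((hX.mlieBracket hW).smul hf).mdiffAt x),
      bracket hf (hX.mlieBracket hW), bracket hf (hY.mlieBracket hW),
      bracket hXf hW, bracket hYf hW] at J
    simp only [Pi.add_apply, Pi.smul_apply', J₀] at J
    rw [← sub_eq_zero] at J
    rw [← neg_eq_zero, ← J]
    module
  by_contra hne
  -- A nonzero coefficient would make the tangent space trivial, where the identity reads `0 = 0`.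
  have hv : ∀ v : TangentSpace I x, v = 0 := fun v ↦
    (smul_eq_zero.1 (key v)).resolve_left fun h ↦ hne (sub_eq_zero.1 h)
  exact hne (by rw [hv (mlieBracket I X Y x), hv (X x), hv (Y x)]; simp)

/-- `d(dη) = 0`, for a one-form with smooth values on smooth vector fields. -/
lemma extD_cyclic_sum [T2Space M] {η : Π x : M, TangentSpace I x →L[ℝ] ℝ}
    (hη : ∀ X : Π x : M, TangentSpace I x, IsSmoothField X →
      ContMDiff I 𝓘(ℝ) ∞ (fun x ↦ η x (X x)))
    (hX : IsSmoothField X) (hY : IsSmoothField Y) (hZ : IsSmoothField Z) (x : M) :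
    mvfderiv I (extD η Y Z) x (X x) + mvfderiv I (extD η Z X) x (Y x)
      + mvfderiv I (extD η X Y) x (Z x)
    = extD η (mlieBracket I X Y) Z x + extD η (mlieBracket I Y Z) X x
      + extD η (mlieBracket I Z X) Y x := by
  have : IsManifold I (minSmoothness ℝ 3) M := 
    IsManifold.of_le (n := ∞) (by simpa using ENat.LEInfty.out)
  have two : ∀ {Z : Π x : M, TangentSpace I x}, IsSmoothField Z →
      CMDiffAt (minSmoothness ℝ 2) (T% Z) x := fun hZ ↦ by
    simpa using (hZ x).of_le (m := 2) ENat.LEInfty.out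
  have d : ∀ {g : M → ℝ}, ContMDiff I 𝓘(ℝ) ∞ g → MDiffAt g x :=
    fun hg ↦ (hg x).mdifferentiableAt (by simp)
  have expand : ∀ {A B : Π x : M, TangentSpace I x}, IsSmoothField A → IsSmoothField B →
      ∀ u : TangentSpace I x, mvfderiv I (extD η A B) x u = (1 / 2) *
        (mvfderiv I (fun y ↦ mvfderiv I (fun y ↦ η y (B y)) y (A y)) x u
        - mvfderiv I (fun y ↦ mvfderiv I (fun y ↦ η y (A y)) y (B y)) x u
        - mvfderiv I (fun y ↦ η y (mlieBracket I A B y)) x u) := by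
    intro A B hA hB u
    have hAB := contMDiff_mvfderiv_apply (hη B hB) hA
    have hBA := contMDiff_mvfderiv_apply (hη A hA) hB
    have hb := hη _ (hA.mlieBracket hB)
    have e : extD η A B = (fun _ ↦ (1 / 2 : ℝ)) *
        (((fun y ↦ mvfderiv I (fun y ↦ η y (B y)) y (A y))
        - (fun y ↦ mvfderiv I (fun y ↦ η y (A y)) y (B y)))
        - (fun y ↦ η y (mlieBracket I A B y))) := rfl
    rw [e, mvfderiv_mul mdifferentiableAt_const (((d hAB).sub (d hBA)).sub (d hb)),
      mvfderiv_sub ((d hAB).sub (d hBA)) (d hb), mvfderiv_sub (d hAB) (d hBA), mvfderiv_const]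
    simp
  -- In cyclic form, Jacobi cancels the double brackets under `η`; the second derivatives are
  -- handled by `mvfderiv_mlieBracket`.
  have J := leibniz_identity_mlieBracket_apply (two hX) (two hY) (two hZ)
  rw [mlieBracket_swap_apply (V := X), mlieBracket_swap_apply (V := Y) (W := mlieBracket I X Z),
    mlieBracket_swap (V := X) (W := Z)] at J
  have neg : mlieBracket I (-mlieBracket I Z X) Y x = - mlieBracket I (mlieBracket I Z X) Y x := by
    have := mlieBracket_const_smul_left (c := (-1 : ℝ)) (W := Y) ((hZ.mlieBracket hX).mdiffAt x)
    simpa using this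
  rw [neg] at J
  have J' := congrArg (η x) J
  simp only [map_neg, map_add] at J'
  rw [expand hY hZ, expand hZ hX, expand hX hY]
  simp only [extD]
  rw [mvfderiv_mlieBracket (hη Z hZ) hX hY, mvfderiv_mlieBracket (hη X hX) hY hZ,
    mvfderiv_mlieBracket (hη Y hY) hZ hX]
  linarith

end SmoothFields

/-! ### Combinatorics of the top power of the standard symplectic form. -/

section Pfaffian

variable {n : ℕ}

/-- The matrix of the standard symplectic form, in a basis indexed by `Fin n × Bool`. -/
def stdSymplectic : Option (Fin n × Bool) → Option (Fin n × Bool) → ℝ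
  | some (i, false), some (j, true) => if i = j then -1 else 0
  | some (i, true), some (j, false) => if i = j then 1 else 0
  | _, _ => 0

/-- A permutation matching the pairs of the standard symplectic basis contributes the same sign
as the identity. -/
lemma sign_mul_prod_stdSymplectic (ρ : Equiv.Perm (Fin n × Bool))
    (h : ∀ i, stdSymplectic (some (ρ (i, false))) (some (ρ (i, true))) ≠ 0) :
    ((Equiv.Perm.sign ρ : ℤ) : ℝ) * ∏ i, stdSymplectic (some (ρ (i, false))) (some (ρ (i, true)))
      = (-1) ^ n := by
  -- Each pair is carried onto a pair, possibly flipped. A flip changes both the sign of `s` and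
  -- that of the form, so the product is `-1` either way.
  have pair : ∀ i, ∃ (j : Fin n) (s : Equiv.Perm Bool), (∀ b, ρ (i, b) = (j, s b)) ∧
      ((Equiv.Perm.sign s : ℤ) : ℝ) * stdSymplectic (some (ρ (i, false))) (some (ρ (i, true)))
        = -1 := by
    intro i
    have hi := h i
    obtain ⟨⟨j, b⟩, hjb⟩ : ∃ p, p = ρ (i, false) := ⟨_, rfl⟩
    obtain ⟨⟨k, c⟩, hkc⟩ : ∃ p, p = ρ (i, true) := ⟨_, rfl⟩
    rw [← hjb, ← hkc] at hi ⊢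
    rcases b <;> rcases c <;> simp only [stdSymplectic, ne_eq, not_true_eq_false, ite_eq_right_iff,
      not_forall] at hi
    · obtain ⟨rfl, -⟩ := hi
      refine ⟨j, 1, ?_, by simp [stdSymplectic]⟩
      rintro (_ | _)
      · exact hjb.symm
      · exact hkc.symm
    · obtain ⟨rfl, -⟩ := hi
      refine ⟨j, Equiv.swap false true, ?_, by simp [stdSymplectic]⟩
      rintro (_ | _)
      · exact hjb.symm
      · exact hkc.symm
  choose τ s hρ hs using pair
  have τinj : Function.Injective τ := by
    intro i j hij
    have : ρ (i, (s i).symm true) = ρ (j, (s j).symm true) := by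
      rw [hρ, hρ]; simp [hij]
    exact congrArg Prod.fst (ρ.injective this)
  let τ' : Equiv.Perm (Fin n) := Equiv.ofBijective τ (Finite.injective_iff_bijective.1 τinj)
  have e : ρ = Equiv.prodCongrLeft (fun _ : Bool ↦ τ') * Equiv.prodCongrRight s := by
    ext1 ⟨i, b⟩
    simp [hρ, τ']
  -- The permutation `τ'` of the pairs acts once on each of the two copies, so its sign is squared
  -- away.
  have hsign : Equiv.Perm.sign ρ = ∏ i, Equiv.Perm.sign (s i) := by
    rw [e, map_mul, Equiv.Perm.sign_prodCongrLeft, Equiv.Perm.sign_prodCongrRight]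
    simp
  rw [hsign]
  push_cast
  rw [← Finset.prod_mul_distrib, Finset.prod_congr rfl fun i _ ↦ hs i]
  simp

/-- The standard pairs `{2 i + 1, 2 i + 2}` in `Fin (2 n + 1)`. -/
def pairEquiv (n : ℕ) : Option (Fin n × Bool) ≃ Fin (2 * n + 1) :=
  ((Equiv.prodCongr (Equiv.refl _) finTwoEquiv.symm).trans
    (finProdFinEquiv.trans (finCongr (Nat.mul_comm n 2)))).optionCongr.trans (finSuccEquiv (2 * n)).symm

lemma pairEquiv_none : pairEquiv n none = 0 := by
  simp [pairEquiv]

lemma pairEquiv_false (i : Fin n) : pairEquiv n (some (i, false)) = ⟨2 * i.1 + 1, by omega⟩ := by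
  ext
  simp [pairEquiv, finProdFinEquiv, finTwoEquiv]

lemma pairEquiv_true (i : Fin n) : pairEquiv n (some (i, true)) = ⟨2 * i.1 + 2, by omega⟩ := by
  ext
  simp [pairEquiv, finProdFinEquiv, finTwoEquiv]
  omega

/-- The full antisymmetrization of `η ⊗ ω ⊗ ⋯ ⊗ ω` does not vanish on a basis in which `η` is the
first coordinate form and `ω` is the standard symplectic form. -/
lemma sum_sign_mul_prod_ne_zero (a : Fin (2 * n + 1) → ℝ)
    (w : Fin (2 * n + 1) → Fin (2 * n + 1) → ℝ)
    (ha : ∀ p, a (pairEquiv n p) = if p = none then 1 else 0)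
    (hw : ∀ p q, w (pairEquiv n p) (pairEquiv n q) = stdSymplectic p q) :
    ∑ σ : Equiv.Perm (Fin (2 * n + 1)), ((Equiv.Perm.sign σ : ℤ) : ℝ) * (a (σ 0) *
      ∏ i : Fin n, w (σ ⟨2 * i.1 + 1, by omega⟩) (σ ⟨2 * i.1 + 2, by omega⟩)) ≠ 0 := by
  rw [← (pairEquiv n).permCongr.sum_comp]
  simp only [← pairEquiv_none, ← pairEquiv_false, ← pairEquiv_true, Equiv.permCongr_apply,
    Equiv.symm_apply_apply, ha, hw, Equiv.Perm.sign_permCongr]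
  -- Up to the common factor `(-1) ^ n` every term is `0` or `1`, and the identity permutation gives
  -- `1`, so the sum is positive.
  have term : ∀ σ : Equiv.Perm (Option (Fin n × Bool)),
      (-1) ^ n * (((Equiv.Perm.sign σ : ℤ) : ℝ) * ((if σ none = none then 1 else 0) *
        ∏ i : Fin n, stdSymplectic (σ (some (i, false))) (σ (some (i, true))))) ∈ ({0, 1} : Set ℝ) := by
    intro σ
    by_cases h₀ : σ none = none
    swap
    · simp [h₀]
    by_cases h : ∀ i, stdSymplectic (σ (some (i, false))) (σ (some (i, true))) ≠ 0
    swap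
    · push Not at h
      obtain ⟨i, hi⟩ := h
      left
      rw [Finset.prod_eq_zero (Finset.mem_univ i) hi]
      simp
    right
    obtain ⟨ρ, rfl⟩ : ∃ ρ : Equiv.Perm (Fin n × Bool), σ = ρ.optionCongr :=
      ⟨Equiv.removeNone σ, by
        rw [map_equiv_removeNone, h₀, Equiv.swap_self]
        rfl⟩
    have := sign_mul_prod_stdSymplectic ρ h
    simp only [Equiv.optionCongr_apply, Option.map_none, Option.map_some, if_true, one_mul,
      Equiv.optionCongr_sign, Set.mem_singleton_iff] at this ⊢
    rw [this, ← mul_pow]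
    simp
  have pos : 0 < ∑ σ : Equiv.Perm (Option (Fin n × Bool)),
      (-1) ^ n * (((Equiv.Perm.sign σ : ℤ) : ℝ) * ((if σ none = none then 1 else 0) *
        ∏ i : Fin n, stdSymplectic (σ (some (i, false))) (σ (some (i, true))))) := by
    refine Finset.sum_pos' (fun σ _ ↦ ?_) ⟨1, Finset.mem_univ _, ?_⟩
    · rcases term σ with h | h
      · exact h.ge
      · rw [h]
        exact zero_le_one
    · simp [stdSymplectic, ← mul_pow]
  rw [← Finset.mul_sum] at pos
  exact right_ne_zero_of_mul pos.ne'

end Pfaffian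

/-! ### Isotropic orthonormal families for a skew endomorphism. -/

section AdaptedFrame

variable {V : Type*} [NormedAddCommGroup V] [InnerProductSpace ℝ V] [FiniteDimensional ℝ V]

/-- A subspace spanned by few vectors has a unit vector orthogonal to it. -/
lemma exists_unit_orthogonal {ι : Type*} [Fintype ι] (b : ι → V)
    (h : Fintype.card ι < Module.finrank ℝ V) :
    ∃ v : V, inner ℝ v v = (1 : ℝ) ∧ ∀ i, inner ℝ v (b i) = (0 : ℝ) := by
  have hlt : (Submodule.span ℝ (Set.range b))ᗮ ≠ ⊥ := by
    intro hbot
    rw [Submodule.orthogonal_eq_bot_iff] at hbot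
    have := finrank_range_le_card (R := ℝ) b
    rw [Set.finrank, hbot, finrank_top] at this
    omega
  obtain ⟨v, hv, hv0⟩ := Submodule.exists_mem_ne_zero_of_ne_bot hlt
  refine ⟨(‖v‖⁻¹ : ℝ) • v, ?_, fun i ↦ ?_⟩
  · have : ‖v‖ ≠ 0 := norm_ne_zero_iff.2 hv0
    rw [inner_smul_left, inner_smul_right, real_inner_self_eq_norm_sq]
    simp
    field_simp
  · rw [inner_smul_left, Submodule.inner_left_of_mem_orthogonal
      (Submodule.subset_span (Set.mem_range_self i)) hv, mul_zero]

/-- If `J` is skew and the dimension is at least `2 k + 1`, there are `k` orthonormal vectors,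
orthogonal to `ξ`, spanning a subspace that is isotropic for `⟪·, J ·⟫`. -/
lemma exists_adapted_frame (J : V →L[ℝ] V) (ξ : V)
    (hskew : ∀ u v, inner ℝ (J u) v = -(inner ℝ u (J v) : ℝ)) (k : ℕ)
    (hk : 2 * k + 1 ≤ Module.finrank ℝ V) :
    ∃ e : Fin k → V, (∀ i, inner ℝ (e i) ξ = (0 : ℝ)) ∧
      (∀ i j, inner ℝ (e i) (e j) = if i = j then (1 : ℝ) else 0) ∧
      ∀ i j, inner ℝ (e i) (J (e j)) = (0 : ℝ) := by
  induction k with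
  | zero => exact ⟨Fin.elim0, fun i ↦ i.elim0, fun i ↦ i.elim0, fun i ↦ i.elim0⟩
  | succ k ih =>
    obtain ⟨e, hξe, he, hJe⟩ := ih (by omega)
    -- The vectors `ξ, e_i, J e_i` number `2 k + 1`, while the dimension is at least `2 k + 3`.
    -- Orthogonality of the new vector to `J v` is automatic by skewness.
    obtain ⟨v, hv, hvb⟩ := exists_unit_orthogonal
      (fun o : Option (Fin k ⊕ Fin k) ↦ o.elim ξ (Sum.elim e (fun i ↦ J (e i)))) (by simp; omega)
    have hvξ : inner ℝ v ξ = (0 : ℝ) := hvb none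
    have hve : ∀ i, inner ℝ v (e i) = (0 : ℝ) := fun i ↦ hvb (some (Sum.inl i))
    have hvJ : ∀ i, inner ℝ v (J (e i)) = (0 : ℝ) := fun i ↦ hvb (some (Sum.inr i))
    have hvv : inner ℝ v (J v) = (0 : ℝ) := by
      have := hskew v v
      rw [real_inner_comm] at this
      linarith
    refine ⟨Fin.snoc (α := fun _ ↦ V) e v, ?_, ?_, ?_⟩
    · intro i
      induction i using Fin.lastCases <;> simp [*]
    · intro i j
      induction i using Fin.lastCases <;> induction j using Fin.lastCases <;>
        simp [hv, hve, he, real_inner_comm v, Fin.castSucc_ne_last, (Fin.castSucc_ne_last _).symm,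
          -inner_self_eq_norm_sq_to_K]
    · intro i j
      have hev : ∀ i, inner ℝ (e i) (J v) = (0 : ℝ) := fun i ↦ by
        have := hskew (e i) v
        rw [real_inner_comm, hvJ] at this
        linarith
      induction i using Fin.lastCases <;> induction j using Fin.lastCases <;>
        simp [hvv, hvJ, hJe, hev]

end AdaptedFrame

/-! ### Covariant derivatives on weak almost contact metric manifolds. -/

section Structures

variable {E : Type*} [NormedAddCommGroup E] [NormedSpace ℝ E]
  {H : Type*} [TopologicalSpace H] {I : ModelWithCorners ℝ E H}
  {M : Type*} [TopologicalSpace M] [ChartedSpace H M] [IsManifold I ∞ M]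
  [RiemannianBundle (fun x : M ↦ TangentSpace I x)]
  [IsContMDiffRiemannianBundle I ∞ E (fun x : M ↦ TangentSpace I x)]
  {φ Q : Π x : M, TangentSpace I x →L[ℝ] TangentSpace I x}
  {ξ : Π x : M, TangentSpace I x} {η : Π x : M, TangentSpace I x →L[ℝ] ℝ}
  {X Y Z : Π x : M, TangentSpace I x}

lemma IsSmoothField.contMDiff_ip (hX : IsSmoothField X) (hY : IsSmoothField Y) :
    ContMDiff I 𝓘(ℝ) ∞ (ip X Y) :=
  ContMDiff.inner_bundle (b := id) hX hY

variable [FiniteDimensional ℝ E]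

lemma nabla_zero_right (X : Π x : M, TangentSpace I x) :
    nabla X (fun _ ↦ 0 : Π x : M, TangentSpace I x) = 0 := by
  funext x
  have : leviCivita I M 0 = 0 := CovariantDerivative.zero _
  exact congrArg (fun A ↦ A x (X x)) this

lemma nabla_sub_nabla (hX : IsSmoothField X) (hY : IsSmoothField Y) (x : M) :
    nabla X Y x - nabla Y X x = mlieBracket I X Y x :=
  (CovariantDerivative.torsion_eq_zero_iff _).1 leviCivita_torsion (hX.mdiffAt x) (hY.mdiffAt x)

lemma mvfderiv_ip (hX : IsSmoothField X) (hY : IsSmoothField Y) (x : M) (u : TangentSpace I x) :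
    mvfderiv I (ip X Y) x u
      = inner ℝ (leviCivita I M X x u) (Y x) + inner ℝ (X x) (leviCivita I M Y x u) :=
  leviCivita_metric (hX.mdiffAt x) (hY.mdiffAt x) u

namespace IsWeakAlmostContactMetric

variable (h : IsWeakAlmostContactMetric φ Q ξ η)
include h

lemma inner_xi (x : M) (u : TangentSpace I x) : inner ℝ u (ξ x) = η x u := by
  have := h.compatible x u (ξ x)
  rw [h.phi_xi, h.Q_xi, h.eta_xi, inner_zero_right] at this
  linarith

/-- Since `Q` is surjective, write `v = Qw` and apply compatibility to `u` and `φw`. -/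
lemma inner_phi_left (x : M) (u v : TangentSpace I x) :
    inner ℝ (φ x u) v = -(inner ℝ u (φ x v) : ℝ) := by
  obtain ⟨w, rfl⟩ := (h.nonsingular x).2 v
  have h₁ := h.compatible x u (φ x w)
  rw [h.phi_sq, h.Q_phi, h.eta_phi, inner_add_right, inner_neg_right, inner_smul_right,
    h.inner_xi, h.eta_phi] at h₁
  linarith

lemma ip_xi : ip X ξ = fun x ↦ η x (X x) := funext fun x ↦ h.inner_xi x (X x)

lemma contMDiff_eta (hX : IsSmoothField X) : ContMDiff I 𝓘(ℝ) ∞ (fun x ↦ η x (X x)) :=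
  h.ip_xi (X := X) ▸ hX.contMDiff_ip h.smooth_xi

lemma nablaEnd_xi (X : Π x : M, TangentSpace I x) (x : M) :
    nablaEnd φ X ξ x = -φ x (nabla X ξ x) := by
  have : (fun y ↦ φ y (ξ y)) = fun _ ↦ 0 := funext h.phi_xi
  rw [nablaEnd, this, nabla_zero_right, Pi.zero_apply, zero_sub]

/-- Separates the derivative of the function `g(φY, Z)` from the connection terms, which combine
into Lie brackets in the cyclic sum. -/
lemma inner_nablaEnd (X : Π x : M, TangentSpace I x) (hY : IsSmoothField Y) (hZ : IsSmoothField Z) (x : M) :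
    inner ℝ (nablaEnd φ X Y x) (Z x)
      = mvfderiv I (ip (fun y ↦ φ y (Y y)) Z) x (X x)
        - inner ℝ (φ x (Y x)) (nabla X Z x) + inner ℝ (nabla X Y x) (φ x (Z x)) := by
  rw [mvfderiv_ip (h.smooth_phi.apply hY) hZ]
  simp only [nablaEnd, inner_sub_left, h.inner_phi_left x (nabla X Y x)]
  simp only [nabla]
  ring

/-- The metric is parallel, so the covariant derivative of the skew `φ` is again skew. -/
lemma inner_nablaEnd_swap (X : Π x : M, TangentSpace I x) (hY : IsSmoothField Y) (hZ : IsSmoothField Z)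
    (x : M) : inner ℝ (nablaEnd φ X Y x) (Z x) = -(inner ℝ (nablaEnd φ X Z x) (Y x) : ℝ) := by
  have e : ip (fun y ↦ φ y (Z y)) Y = -ip (fun y ↦ φ y (Y y)) Z := by
    funext y
    simp only [ip, Pi.neg_apply, h.inner_phi_left y (Z y), real_inner_comm]
  rw [h.inner_nablaEnd X hY hZ, h.inner_nablaEnd X hZ hY, e, mvfderiv_neg]
  rw [real_inner_comm (φ x (Y x)) (nabla X Z x), real_inner_comm (φ x (Z x)) (nabla X Y x)]
  simp
  ring

/-- The cyclic sum of `g((∇_X φ) Y, Z)` vanishes if `dη = g(·, φ ·)`. -/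
lemma cyclic_sum_nablaEnd [T2Space M]
    (hd : ∀ X Y : Π x : M, TangentSpace I x, IsSmoothField X → IsSmoothField Y →
      ∀ x, extD η X Y x = inner ℝ (X x) (φ x (Y x)))
    (hX : IsSmoothField X) (hY : IsSmoothField Y) (hZ : IsSmoothField Z) (x : M) :
    (inner ℝ (nablaEnd φ X Y x) (Z x) : ℝ) + inner ℝ (nablaEnd φ Y Z x) (X x)
      + inner ℝ (nablaEnd φ Z X x) (Y x) = 0 := by
  have e : ∀ {A B : Π x : M, TangentSpace I x}, IsSmoothField A → IsSmoothField B →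
      ip (fun y ↦ φ y (A y)) B = -extD η A B := fun hA hB ↦ funext fun y ↦ by
    rw [Pi.neg_apply, hd _ _ hA hB]
    exact h.inner_phi_left y _ _
  have c := extD_cyclic_sum (fun _ hX ↦ h.contMDiff_eta hX) hX hY hZ x
  rw [hd _ _ (hX.mlieBracket hY) hZ, hd _ _ (hY.mlieBracket hZ) hX, hd _ _ (hZ.mlieBracket hX) hY,
    ← nabla_sub_nabla hX hY, ← nabla_sub_nabla hY hZ, ← nabla_sub_nabla hZ hX] at c
  simp only [inner_sub_left] at c
  rw [h.inner_nablaEnd X hY hZ, h.inner_nablaEnd Y hZ hX, h.inner_nablaEnd Z hX hY,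
    e hX hY, e hY hZ, e hZ hX, real_inner_comm (nabla X Z x), real_inner_comm (nabla Y X x),
    real_inner_comm (nabla Z Y x)]
  simp only [mvfderiv_neg, neg_apply]
  linarith

end IsWeakAlmostContactMetric

lemma nablaEnd_add_left (X X' Y : Π x : M, TangentSpace I x) (x : M) :
    nablaEnd φ (X + X') Y x = nablaEnd φ X Y x + nablaEnd φ X' Y x := by
  simp only [nablaEnd, nabla, Pi.add_apply, map_add]
  abel

lemma nablaEnd_add_right (hφ : IsSmoothEnd φ) (X : Π x : M, TangentSpace I x)
    (hY : IsSmoothField Y) (hZ : IsSmoothField Z) (x : M) :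
    nablaEnd φ X (Y + Z) x = nablaEnd φ X Y x + nablaEnd φ X Z x := by
  have e : (fun y ↦ φ y ((Y + Z) y)) = (fun y ↦ φ y (Y y)) + fun y ↦ φ y (Z y) := by
    funext y; simp
  have a : ∀ {A B : Π x : M, TangentSpace I x}, IsSmoothField A → IsSmoothField B →
      nabla X (A + B) x = nabla X A x + nabla X B x := fun hA hB ↦ by
    have := (leviCivita I M).isCovariantDerivativeOnUniv.add (hA.mdiffAt x) (hB.mdiffAt x)
    exact congrArg (fun A ↦ A (X x)) this
  rw [nablaEnd, e, a (hφ.apply hY) (hφ.apply hZ), a hY hZ, map_add, nablaEnd, nablaEnd]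
  abel

/-- The symmetrized form of the weak nearly Sasakian condition. -/
lemma IsWeakNearlySasakian.nablaEnd_add_nablaEnd (h : IsWeakNearlySasakian φ Q ξ η)
    (hX : IsSmoothField X) (hY : IsSmoothField Y) (x : M) :
    nablaEnd φ X Y x + nablaEnd φ Y X x
      = (2 * inner ℝ (X x) (Y x) : ℝ) • ξ x - η x (X x) • Y x - η x (Y x) • X x := by
  -- Polarization: the quadratic condition is evaluated at `X + Y`.
  have h₁ := h.nearly _ (hX.add hY) x
  rw [nablaEnd_add_left, nablaEnd_add_right h.smooth_phi _ hX hY,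
    nablaEnd_add_right h.smooth_phi _ hX hY, h.nearly X hX, h.nearly Y hY] at h₁
  simp only [Pi.add_apply, inner_add_left, inner_add_right, map_add,
    real_inner_comm (X x) (Y x)] at h₁
  rw [← sub_eq_zero] at h₁ ⊢
  rw [← h₁]
  module

lemma nabla_xi_of_hTensor_eq_zero (hh : ∀ x, hTensor φ ξ x = 0) (X : Π x : M, TangentSpace I x)
    (x : M) : nabla X ξ x = -φ x (X x) := by
  have := congrArg (fun A ↦ A (X x)) (hh x)
  exact eq_neg_of_add_eq_zero_left this

/-- If `h = 0`, the structure is weak contact metric. -/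
lemma IsWeakAlmostContactMetric.extD_eq_of_hTensor_eq_zero (h : IsWeakAlmostContactMetric φ Q ξ η)
    (hh : ∀ x, hTensor φ ξ x = 0) (hX : IsSmoothField X) (hY : IsSmoothField Y) (x : M) :
    extD η X Y x = inner ℝ (X x) (φ x (Y x)) := by
  rw [extD, ← h.ip_xi, ← h.ip_xi, mvfderiv_ip hY h.smooth_xi, mvfderiv_ip hX h.smooth_xi,
    ← h.inner_xi, ← nabla_sub_nabla hX hY, inner_sub_left]
  have e₁ := nabla_xi_of_hTensor_eq_zero hh X x
  have e₂ := nabla_xi_of_hTensor_eq_zero hh Y x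
  simp only [nabla] at e₁ e₂ ⊢
  rw [e₁, e₂, inner_neg_right, inner_neg_right, real_inner_comm (φ x (X x)) (Y x),
    h.inner_phi_left, real_inner_comm (ξ x) (leviCivita I M X x (Y x))]
  ring

lemma IsWeakAlmostContactMetric.isWeakContactMetric_of_hTensor_eq_zero
    (h : IsWeakAlmostContactMetric φ Q ξ η) (hh : ∀ x, hTensor φ ξ x = 0) : IsWeakContactMetric φ Q ξ η where
  toIsWeakAlmostContactMetric := h
  extD_eq _ _ hX hY x := h.extD_eq_of_hTensor_eq_zero hh hX hY x

/-! ### Consequences of `h = 0`. -/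

namespace IsWeakNearlySasakian

variable [T2Space M] (h : IsWeakNearlySasakian φ Q ξ η) (hh : ∀ x, hTensor φ ξ x = 0)
include h hh

/-- If `h = 0`, the covariant derivative of `φ` is that of a Sasakian structure. -/
lemma nablaEnd_eq_of_hTensor_eq_zero (hX : IsSmoothField X) (hY : IsSmoothField Y) (x : M) :
    nablaEnd φ X Y x = (inner ℝ (X x) (Y x) : ℝ) • ξ x - η x (Y x) • X x := by
  refine ext_inner_right ℝ fun v ↦ ?_
  obtain ⟨Z, hZ, rfl⟩ := exists_isSmoothField_eq x v
  -- With `T(X,Y,Z) = g((∇_X φ)Y, Z)`, skewness turns the three relations into `a + b - c = 0`, `a -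
  -- b = s₁`, `b + c = s₂` for `a = T(X,Y,Z)`, `b = T(Y,Z,X)`, `c = T(Z,Y,X)`. Hence `3a = 2s₁ +
  -- s₂`.
  have c := h.cyclic_sum_nablaEnd (fun _ _ hX hY x ↦ h.extD_eq_of_hTensor_eq_zero hh hX hY x)
    hX hY hZ x
  have s₁ := congrArg (fun u ↦ inner ℝ u (Z x) : _ → ℝ) (h.nablaEnd_add_nablaEnd hX hY x)
  have s₂ := congrArg (fun u ↦ inner ℝ u (X x) : _ → ℝ) (h.nablaEnd_add_nablaEnd hY hZ x)
  have w₁ := h.inner_nablaEnd_swap Y hX hZ x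
  have w₂ := h.inner_nablaEnd_swap Z hX hY x
  simp only [inner_add_left, inner_sub_left, inner_smul_left, conj_trivial,
    real_inner_comm _ (ξ x), h.inner_xi] at s₁ s₂ ⊢
  rw [real_inner_comm (X x) (Z x), real_inner_comm (X x) (Y x)] at s₂
  linarith

/-- At `Y = ξ`, `(∇_X φ)ξ = -φ(∇_X ξ) = φ²X = -QX + η(X)ξ`, while the Sasakian formula gives `η(X)ξ
- X`. -/
lemma QTilde_eq_zero_of_hTensor_eq_zero (x : M) : QTilde Q x = 0 := by
  ext1 v
  obtain ⟨X, hX, rfl⟩ := exists_isSmoothField_eq x v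
  have e := h.nablaEnd_eq_of_hTensor_eq_zero hh hX h.smooth_xi x
  rw [h.nablaEnd_xi, nabla_xi_of_hTensor_eq_zero hh, map_neg, neg_neg, h.phi_sq, h.inner_xi,
    h.eta_xi, one_smul, neg_add_eq_sub] at e
  exact sub_eq_zero.2 (sub_right_injective e)

lemma isSasakian_of_hTensor_eq_zero : IsSasakian φ ξ η where
  almostContactMetric := by
    have e : Q = fun x ↦ ContinuousLinearMap.id ℝ (TangentSpace I x) :=
      funext fun x ↦ sub_eq_zero.1 (h.QTilde_eq_zero_of_hTensor_eq_zero hh x)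
    have h' := h.toIsWeakAlmostContactMetric
    rwa [e] at h'
  sasaki _ _ hX hY x := h.nablaEnd_eq_of_hTensor_eq_zero hh hX hY x

/-- If `h = 0`, the planes containing `ξ` have sectional curvature one. -/
lemma sectionalCurvature_xi_of_hTensor_eq_zero (hX : IsSmoothField X) (x : M)
    (hli : LinearIndependent ℝ ![ξ x, X x]) : sectionalCurvature X ξ x = 1 := by
  have n₁ : ∀ Y : Π x : M, TangentSpace I x, nabla Y ξ = -fun x ↦ φ x (Y x) :=
    fun Y ↦ funext fun x ↦ nabla_xi_of_hTensor_eq_zero hh Y x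
  have n₂ : nabla ξ ξ = fun _ ↦ 0 := by
    rw [n₁]
    funext x
    simp [h.phi_xi]
  have n₃ : nabla ξ (nabla X ξ) x = -nabla ξ (fun y ↦ φ y (X y)) x := by
    have := (leviCivita I M).isCovariantDerivativeOnUniv.smul_const (-1 : ℝ)
      ((h.smooth_phi.apply hX).mdiffAt x)
    rw [n₁]
    simp only [nabla]
    have e : (-fun x ↦ φ x (X x)) = (-1 : ℝ) • fun x ↦ φ x (X x) := by simp
    rw [e]
    exact (congrArg (fun A ↦ A (ξ x)) this).trans (by simp; rfl)
  have s := h.nablaEnd_eq_of_hTensor_eq_zero hh h.smooth_xi hX x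
  have b := nabla_sub_nabla hX h.smooth_xi x
  -- As `∇_ξ ξ = 0`, the curvature is `∇_ξ(φX) + φ[X, ξ]`. Here `∇_ξ(φX) = φ(∇_ξ X)` and `[X, ξ] =
  -- -φX - ∇_ξ X`, which leaves `-φ²X`.
  have curv : curvature X ξ ξ x = X x - η x (X x) • ξ x := by
    have q := congrArg (φ x) b
    have qs := h.phi_sq x (X x)
    have Qid : Q x (X x) = X x := by
      have := congrArg (fun A ↦ A (X x)) (h.QTilde_eq_zero_of_hTensor_eq_zero hh x)
      exact sub_eq_zero.1 this
    rw [n₁ X, Pi.neg_apply, map_sub, map_neg, qs, Qid] at q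
    rw [real_inner_comm, h.inner_xi, sub_self, nablaEnd, sub_eq_zero] at s
    rw [curvature, n₂, nabla_zero_right, n₃, n₁ (mlieBracket I X ξ), Pi.neg_apply, ← q, s, Pi.zero_apply]
    module
  -- The Gram determinant is `|X - η(X)ξ|²`, which is also the curvature numerator; it vanishes only
  -- if `X` is a multiple of `ξ`.
  have gram : (inner ℝ (X x) (X x) : ℝ) - η x (X x) ^ 2 ≠ 0 := by
    intro h0
    have z : X x - η x (X x) • ξ x = 0 := by
      rw [← inner_self_eq_zero (𝕜 := ℝ)]
      simp only [inner_sub_left, inner_sub_right, inner_smul_left, inner_smul_right, conj_trivial,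
        real_inner_comm (X x) (ξ x), h.inner_xi, h.eta_xi,
        map_sub, map_smul, smul_eq_mul]
      linarith
    have := LinearIndependent.pair_iff.1 hli (-η x (X x)) 1 (by rw [← z]; module)
    exact one_ne_zero this.2
  rw [sectionalCurvature, curv, inner_sub_left, inner_smul_left, real_inner_comm (X x) (ξ x),
    h.inner_xi, h.inner_xi, h.eta_xi, conj_trivial, mul_one, ← sq]
  exact div_self gram

end IsWeakNearlySasakian

/-- On a Sasakian manifold `∇ξ = -φ`. -/
lemma IsSasakian.hTensor_eq_zero [T2Space M] (h : IsSasakian φ ξ η) (x : M) :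
    hTensor φ ξ x = 0 := by
  have hc : IsWeakAlmostContactMetric φ _ ξ η := h.almostContactMetric
  ext1 v
  obtain ⟨X, hX, rfl⟩ := exists_isSmoothField_eq x v
  have e := h.sasaki X ξ hX hc.smooth_xi x
  rw [hc.nablaEnd_xi, hc.inner_xi, hc.eta_xi, one_smul] at e
  have hφ : φ x (hTensor φ ξ x (X x)) = 0 := by
    have : φ x (hTensor φ ξ x (X x)) = φ x (nabla X ξ x) + φ x (φ x (X x)) := map_add _ _ _
    rw [this, hc.phi_sq, neg_eq_iff_eq_neg.1 e]
    simp
  -- Differentiating `g(ξ, ξ) = 1` shows that `∇_X ξ` is orthogonal to `ξ`.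
  have hη : η x (hTensor φ ξ x (X x)) = 0 := by
    have n : ip ξ ξ = fun _ ↦ (1 : ℝ) := by
      rw [hc.ip_xi]
      exact funext hc.eta_xi
    have d := mvfderiv_ip hc.smooth_xi hc.smooth_xi x (X x)
    rw [n, mvfderiv_const, real_inner_comm (leviCivita I M ξ x (X x)), hc.inner_xi] at d
    have : η x (hTensor φ ξ x (X x)) = η x (leviCivita I M ξ x (X x)) + η x (φ x (X x)) :=
      map_add _ _ _
    rw [this, hc.eta_phi]
    simp at d
    linarith
  have sq := hc.phi_sq x (hTensor φ ξ x (X x))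
  rw [hφ, hη] at sq
  simpa using sq

/-- A `(2n+1)`-dimensional almost contact metric structure with `dη = g(·, φ ·)` is contact. -/
lemma IsWeakContactMetric.isContactForm [T2Space M] (h : IsWeakContactMetric φ Q ξ η)
    (hQ : ∀ x, QTilde Q x = 0) {n : ℕ} (hn : Module.finrank ℝ E = 2 * n + 1) :
    IsContactForm n η := by
  intro x
  have : FiniteDimensional ℝ (TangentSpace I x) := inferInstanceAs (FiniteDimensional ℝ E)
  have hfr : Module.finrank ℝ (TangentSpace I x) = 2 * n + 1 := hn
  obtain ⟨e, heξ, hee, heφ⟩ := exists_adapted_frame (φ x) (ξ x) (h.inner_phi_left x) n hfr.ge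
  have hsq : ∀ u : TangentSpace I x, φ x (φ x u) = -u + η x u • ξ x := fun u ↦ by
    have := congrArg (fun A ↦ A u) (hQ x)
    have Qu : Q x u = u := sub_eq_zero.1 this
    rw [h.phi_sq, Qu]
  have hηe : ∀ i, η x (e i) = 0 := fun i ↦ by rw [← h.inner_xi, heξ]
  -- In this frame `dη(e_i, φ e_j) = g(e_i, φ² e_j) = -δ_ij`, hence the sign convention of
  -- `stdSymplectic`.
  let b : Option (Fin n × Bool) → TangentSpace I x
    | none => ξ x
    | some (i, false) => e i
    | some (i, true) => φ x (e i)
  choose X hX hXb using fun i ↦ exists_isSmoothField_eq x (b ((pairEquiv n).symm i))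
  refine ⟨X, hX, mul_ne_zero (by positivity) ?_⟩
  refine sum_sign_mul_prod_ne_zero (fun i ↦ η x (X i x)) (fun i j ↦ extD η (X i) (X j) x) ?_ ?_
  · rintro (_ | ⟨i, _ | _⟩) <;> simp [hXb, b, h.eta_xi, h.eta_phi, hηe]
  · have hφe : ∀ i j, inner ℝ (φ x (e i)) (φ x (e j)) = if i = j then (1 : ℝ) else 0 := by
      intro i j
      rw [h.inner_phi_left, hsq, hηe, zero_smul, add_zero, inner_neg_right, neg_neg, hee]
    have hξφ : ∀ u, inner ℝ (ξ x) (φ x u) = (0 : ℝ) := fun u ↦ by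
      rw [real_inner_comm, h.inner_xi, h.eta_phi]
    have hξe : ∀ i, inner ℝ (ξ x) (e i) = (0 : ℝ) := fun i ↦ by rw [real_inner_comm, heξ]
    have hφe' : ∀ i j, inner ℝ (φ x (e i)) (e j) = (0 : ℝ) := fun i j ↦ by
      rw [real_inner_comm, heφ]
    rintro (_ | ⟨i, _ | _⟩) (_ | ⟨j, _ | _⟩) <;>
      simp [h.extD_eq _ _ (hX _) (hX _), hXb, b, stdSymplectic, h.phi_xi, hsq, hηe, hee, heφ, hφe,
        hξφ, hξe, hφe', apply_ite]

end Structures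

end WeakContact

end

theorem proposition4p1 (n : ℕ) (hn : 1 ≤ n)
    {M : Type*} [TopologicalSpace M] [T2Space M]
    [ChartedSpace (EuclideanSpace ℝ (Fin (2 * n + 1))) M] [IsManifold (𝓡 (2 * n + 1)) ∞ M]
    [RiemannianBundle (fun x : M ↦ TangentSpace (𝓡 (2 * n + 1)) x)]
    [IsContMDiffRiemannianBundle (𝓡 (2 * n + 1)) ∞ (EuclideanSpace ℝ (Fin (2 * n + 1)))
      (fun x : M ↦ TangentSpace (𝓡 (2 * n + 1)) x)]
    (φ Q : Π x : M, TangentSpace (𝓡 (2 * n + 1)) x →L[ℝ] TangentSpace (𝓡 (2 * n + 1)) x)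
    (ξ : Π x : M, TangentSpace (𝓡 (2 * n + 1)) x)
    (η : Π x : M, TangentSpace (𝓡 (2 * n + 1)) x →L[ℝ] ℝ)
    (hM : WeakContact.IsWeakNearlySasakian φ Q ξ η) :
    ((∀ x, WeakContact.hTensor φ ξ x = 0) ↔ WeakContact.IsSasakian φ ξ η) ∧
    ((∀ x, WeakContact.hTensor φ ξ x = 0) →
      (∀ x, WeakContact.QTilde Q x = 0) ∧
      WeakContact.IsWeakContactMetric φ Q ξ η ∧
      WeakContact.IsContactForm n η ∧
      ∀ X : Π x : M, TangentSpace (𝓡 (2 * n + 1)) x, WeakContact.IsSmoothField X →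
        ∀ x, LinearIndependent ℝ ![ξ x, X x] → WeakContact.sectionalCurvature X ξ x = 1) := by
  have fwd := fun hh ↦ hM.isSasakian_of_hTensor_eq_zero hh
  refine ⟨⟨fwd, fun h ↦ h.hTensor_eq_zero⟩, fun hh ↦ ?_⟩
  have hQ := hM.QTilde_eq_zero_of_hTensor_eq_zero hh
  have hc := hM.isWeakContactMetric_of_hTensor_eq_zero hh
  exact ⟨hQ, hc, hc.isContactForm hQ finrank_euclideanSpace_fin,
    fun X hX x hli ↦ hM.sectionalCurvature_xi_of_hTensor_eq_zero hh hX x hli⟩
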